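/- Let $(R,\mathfrak m)$ be a commutative noetherian local ring of Krull dimension $3$ that is Cohen–Macaulay (i.e. $\operatorname{depth} R=\dim R=3$), and let $M$ be a finitely generated $R$-module that is reflexive (the canonical map $M\to M^{**}$, where $(-)^*=\operatorname{Hom}_R(-,R)$, is an isomorphism) and has finite projective dimension, $\operatorname{pd}_R(M)<\infty$. If the tensor power $M^{\otimes 3}=M\otimes_R M\otimes_R M$ is torsion-free (no non-zero-divisor of $R$ kills a nonzero element of it), then $M$ is a free $R$-module. -/

import Mathlib

universe u v

open scoped TensorProduct

/-- The depth of a local ring `(R, 𝔪)`: the supremum of the lengths of the `R`-regular sequences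
all of whose members lie in `𝔪`. -/
noncomputable def localRingDepth (R : Type*) [CommRing R] [IsLocalRing R] : ℕ∞ :=
  ⨆ (rs : List R) (_ : RingTheory.Sequence.IsRegular R rs ∧
    ∀ r ∈ rs, r ∈ IsLocalRing.maximalIdeal R), (rs.length : ℕ∞)

/-- A (noetherian) local ring is Cohen-Macaulay if its depth equals its Krull dimension. -/
class IsCohenMacaulayLocalRing (R : Type*) [CommRing R] : Prop
    extends IsLocalRing R, IsNoetherianRing R where
  depth_eq_dim : (localRingDepth R : WithBot ℕ∞) = ringKrullDim R

/-! Reflexivity gives M depth at least 2, so its first syzygy has depth 3 and, by an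
Auslander–Buchsbaum argument, is free: there is a minimal resolution 0 → F₁ → F₀ → M → 0 with first
map A. The aim is F₁ = 0.

Torsion-freeness of M makes the cokernel of the dual of A have grade at least 2, so a regular pair
x, y kills it. Then x and y kill every kernel of N ⊗ A, that is, Tor₁(N, M). Since x, y is regular
on M, this makes M ⊗ A and then (M ⊗ M) ⊗ A injective.

Minimality makes A act as zero on Ext(k, -), so the connecting map from Extⁱ(k, N ⊗ M) to Extⁱ⁺¹(k,
N ⊗ F₁) is onto. If F₁ ≠ 0, the vanishing of Hom(k, M ⊗ M ⊗ M) climbs to Ext¹(k, M ⊗ M) = 0, Ext²(k,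
M) = 0 and Ext³(k, F₁) = 0, contradicting depth R = 3 (`subsingleton_of_tensorPower_isTorsionFree`).
-/

section Presentation

variable {R : Type u} [CommRing R] [IsLocalRing R]

open IsLocalRing in
/-- A finitely generated module over a local ring has a minimal free cover. -/
theorem exists_minimal_free_cover [Small.{v} R] (M : Type v) [AddCommGroup M] [Module R M]
    [Module.Finite R M] :
    ∃ (F : Type v) (_ : AddCommGroup F) (_ : Module R F) (_ : Module.Free R F)
      (_ : Module.Finite R F) (π : F →ₗ[R] M), Function.Surjective π ∧
        LinearMap.ker π ≤ maximalIdeal R • (⊤ : Submodule R F) := by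
  let b := Module.finBasis (ResidueField R) (ResidueField R ⊗[R] M)
  have hs : Function.Surjective (TensorProduct.mk R (ResidueField R) M 1) :=
    TensorProduct.mk_surjective R M _ Ideal.Quotient.mk_surjective
  choose f hf using fun i ↦ hs (b i)
  have hspan := span_eq_top_of_tmul_eq_basis f b hf
  let n := Module.finrank (ResidueField R) (ResidueField R ⊗[R] M)
  let p : (Fin n → R) →ₗ[R] M := Fintype.linearCombination R f
  have hp : Function.Surjective p := by
    rw [← LinearMap.range_eq_top, Fintype.range_linearCombination, hspan]
  let e : Shrink.{v} (Fin n → R) ≃ₗ[R] (Fin n → R) := Shrink.linearEquiv R _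
  have hker : LinearMap.ker p ≤ maximalIdeal R • (⊤ : Submodule R (Fin n → R)) := by
    intro x hx
    have h0 : ∑ i, (residue R (x i)) • b i = 0 := by
      have : (1 : ResidueField R) ⊗ₜ[R] p x = 0 := by
        rw [LinearMap.mem_ker.1 hx, TensorProduct.tmul_zero]
      rw [Fintype.linearCombination_apply, TensorProduct.tmul_sum] at this
      rw [← this]
      refine Finset.sum_congr rfl fun i _ ↦ ?_
      rw [← hf i, TensorProduct.mk_apply, TensorProduct.tmul_smul, TensorProduct.smul_tmul',
        TensorProduct.smul_tmul']
      simp [Algebra.smul_def]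
    have h1 := Fintype.linearIndependent_iff.1 b.linearIndependent _ h0
    rw [pi_eq_sum_univ' x]
    refine Submodule.sum_mem _ fun i _ ↦ Submodule.smul_mem_smul ?_ trivial
    exact (residue_eq_zero_iff _).1 (h1 i)
  refine ⟨Shrink.{v} (Fin n → R), inferInstance, inferInstance, Module.Free.of_equiv e.symm,
    Module.Finite.equiv e.symm, p ∘ₗ e.toLinearMap, hp.comp e.surjective, fun x hx ↦ ?_⟩
  have := Submodule.mem_map_of_mem (f := e.symm.toLinearMap) (hker (x := e x) (by simpa using hx))
  rw [Submodule.map_smul''] at this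
  rw [LinearEquiv.coe_coe, e.symm_apply_apply] at this
  exact Submodule.smul_mono le_rfl le_top this

end Presentation

/-! ### Minimality as membership in an ideal multiple of Hom -/

section IdealSmul

variable {R : Type u} [CommRing R] {F G : Type*} [AddCommGroup F] [Module R F]
  [AddCommGroup G] [Module R G]

/-- A linear map out of a finite free module whose range lies in `I • ⊤` is a combination of linear
maps with coefficients in `I`. -/
theorem LinearMap.mem_ideal_smul_top_of_range_le [Module.Free R F] [Module.Finite R F]
    {I : Ideal R} {f : F →ₗ[R] G} (hf : LinearMap.range f ≤ I • (⊤ : Submodule R G)) :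
    f ∈ I • (⊤ : Submodule R (F →ₗ[R] G)) := by
  let b := Module.Free.chooseBasis R F
  have key : f = ∑ i, (LinearMap.toSpanSingleton R G (f (b i))) ∘ₗ b.coord i := by
    refine b.ext fun j ↦ ?_
    simp [Finsupp.single_apply]
  rw [key]
  refine Submodule.sum_mem _ fun i _ ↦ ?_
  refine Submodule.smul_induction_on (p := fun g ↦ (LinearMap.toSpanSingleton R G g) ∘ₗ b.coord i ∈
    I • (⊤ : Submodule R (F →ₗ[R] G))) (hf ⟨b i, rfl⟩) (fun r hr g _ ↦ ?_) fun g g' h h' ↦ ?_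
  · have : (LinearMap.toSpanSingleton R G (r • g)) ∘ₗ b.coord i =
        r • ((LinearMap.toSpanSingleton R G g) ∘ₗ b.coord i) := by
      ext x; exact smul_comm _ _ _
    rw [this]
    exact Submodule.smul_mem_smul hr trivial
  · have : (LinearMap.toSpanSingleton R G (g + g')) ∘ₗ b.coord i =
        (LinearMap.toSpanSingleton R G g) ∘ₗ b.coord i +
          (LinearMap.toSpanSingleton R G g') ∘ₗ b.coord i := by
      ext x; simp
    rw [this]
    exact add_mem h h'

/-- Tensoring is linear in the map, so minimality survives it. This is why minimality is phrased in
Hom: N ⊗ F need not be free. -/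
theorem LinearMap.lTensor_mem_ideal_smul_top {I : Ideal R} {f : F →ₗ[R] G}
    (hf : f ∈ I • (⊤ : Submodule R (F →ₗ[R] G))) (N : Type*) [AddCommGroup N] [Module R N] :
    f.lTensor N ∈ I • (⊤ : Submodule R (N ⊗[R] F →ₗ[R] N ⊗[R] G)) := by
  have := Submodule.mem_map_of_mem (f := LinearMap.lTensorHom (R := R) N) hf
  rw [Submodule.map_smul''] at this
  exact Submodule.smul_mono le_rfl le_top this

end IdealSmul

/-! ### Regular pairs on reflexive modules and on tensor products with free modules -/

section RegularPairs

variable {R : Type u} [CommRing R]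

/-- `x, y` is a weakly regular sequence on `M`, expressed with elements. -/
structure IsWeaklyRegularPair (M : Type*) [AddCommGroup M] [Module R M] (x y : R) : Prop where
  left : IsSMulRegular M x
  right : ∀ a b : M, y • a = x • b → ∃ c, a = x • c

variable {M N : Type*} [AddCommGroup M] [Module R M] [AddCommGroup N] [Module R N]

theorem IsSMulRegular.eq_zero_of_smul {x : R} (h : IsSMulRegular M x) {m : M} (hm : x • m = 0) :
    m = 0 := h (by simpa using hm)

theorem isSMulRegular_quotSMulTop_iff {x y : R} :
    IsSMulRegular (QuotSMulTop x M) y ↔ ∀ a b : M, y • a = x • b → ∃ c, a = x • c := by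
  rw [isSMulRegular_iff_right_eq_zero_of_smul]
  constructor
  · intro h a b hab
    have := h (Submodule.Quotient.mk a) (by
      rw [← Submodule.Quotient.mk_smul, Submodule.Quotient.mk_eq_zero, hab]
      exact Submodule.smul_mem_pointwise_smul _ _ _ trivial)
    rw [Submodule.Quotient.mk_eq_zero, Submodule.mem_smul_pointwise_iff_exists] at this
    obtain ⟨c, -, hc⟩ := this
    exact ⟨c, hc.symm⟩
  · intro h a ha
    obtain ⟨a, rfl⟩ := Submodule.Quotient.mk_surjective _ a
    rw [← Submodule.Quotient.mk_smul, Submodule.Quotient.mk_eq_zero,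
      Submodule.mem_smul_pointwise_iff_exists] at ha
    obtain ⟨b, -, hb⟩ := ha
    obtain ⟨c, rfl⟩ := h a b hb.symm
    rw [Submodule.Quotient.mk_eq_zero]
    exact Submodule.smul_mem_pointwise_smul _ _ _ trivial

theorem isWeaklyRegularPair_iff {x y : R} :
    IsWeaklyRegularPair M x y ↔ RingTheory.Sequence.IsWeaklyRegular M [x, y] := by
  rw [RingTheory.Sequence.isWeaklyRegular_cons_iff,
    RingTheory.Sequence.isWeaklyRegular_singleton_iff, isSMulRegular_quotSMulTop_iff]
  exact ⟨fun h ↦ ⟨h.1, h.2⟩, fun h ↦ ⟨h.1, h.2⟩⟩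

theorem Module.IsReflexive.isTorsionFree [Module.IsReflexive R M] : Module.IsTorsionFree R M where
  isSMulRegular r hr := by
    rw [isSMulRegular_iff_right_eq_zero_of_smul]
    intro m hm
    refine (Module.bijective_dual_eval R M).injective (LinearMap.ext fun f ↦ ?_)
    have : r • f m = r • 0 := by rw [← map_smul, hm]; simp
    simpa using hr.1 this

/-- A regular sequence of length two on the ring is regular on every reflexive module. -/
theorem IsWeaklyRegularPair.of_isReflexive [Module.IsReflexive R M] {x y : R}
    (h : IsWeaklyRegularPair R x y) : IsWeaklyRegularPair M x y where
  left := by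
    have := Module.IsReflexive.isTorsionFree (R := R) (M := M)
    exact (Module.IsTorsionFree.isSMulRegular (isLeftRegular_iff_isRegular.1 h.left))
  right a b hab := by
    have key (f : Module.Dual R M) : ∃ c, f a = x • c :=
      h.right (f a) (f b) (by rw [← map_smul, hab, map_smul])
    -- As x is regular, the quotients f(a)/x are unique, hence linear in f; reflexivity realizes
    -- them by an element of M.
    choose g hg using key
    let G : Module.Dual R (Module.Dual R M) :=
      { toFun := g
        map_add' := fun f f' ↦ h.left (by
          change x • _ = x • _
          rw [smul_add, ← hg, ← hg, ← hg, LinearMap.add_apply])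
        map_smul' := fun r f ↦ h.left (by
          change x • _ = x • _
          rw [RingHom.id_apply, smul_comm, ← hg, ← hg, LinearMap.smul_apply]) }
    obtain ⟨c, hc⟩ := (Module.bijective_dual_eval R M).surjective G
    refine ⟨c, (Module.bijective_dual_eval R M).injective (LinearMap.ext fun f ↦ ?_)⟩
    have h2 : f c = g f := LinearMap.congr_fun hc f
    simp [hg f, h2]

theorem IsSMulRegular.tensor_free {x : R} (h : IsSMulRegular M x) (F : Type*) [AddCommGroup F]
    [Module R F] [Module.Free R F] : IsSMulRegular (M ⊗[R] F) x := by
  let e := TensorProduct.equivFinsuppOfBasisRight (M := M) (Module.Free.chooseBasis R F)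
  rw [isSMulRegular_iff_right_eq_zero_of_smul]
  intro m hm
  refine e.injective (Finsupp.ext fun i ↦ ?_)
  rw [map_zero]
  refine h.eq_zero_of_smul ?_
  rw [← Finsupp.smul_apply, ← map_smul, hm]
  simp

theorem IsWeaklyRegularPair.tensor_free {x y : R} (h : IsWeaklyRegularPair M x y) (F : Type*)
    [AddCommGroup F] [Module R F] [Module.Free R F] : IsWeaklyRegularPair (M ⊗[R] F) x y where
  left := h.left.tensor_free F
  right a b hab := by
    let e := TensorProduct.equivFinsuppOfBasisRight (M := M) (Module.Free.chooseBasis R F)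
    have key (i) : ∃ c, e a i = x • c := h.right (e a i) (e b i) (by
      rw [← Finsupp.smul_apply, ← map_smul, hab, map_smul, Finsupp.smul_apply])
    choose c hc using key
    -- Needed so that the chosen quotients have finite support.
    have hz (i) (hi : e a i = 0) : c i = 0 := h.left.eq_zero_of_smul (by rw [← hc, hi])
    refine ⟨e.symm (Finsupp.onFinset (e a).support c fun i hi ↦ ?_), ?_⟩
    · rw [Finsupp.mem_support_iff]
      exact fun h ↦ hi (hz i h)
    · rw [← map_smul, LinearEquiv.eq_symm_apply]
      ext i
      simp [hc]

/-- If no nonzero element of `M` is killed by both `x` and `y`, the same holds for `M ⊗ F` with `F`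
free. -/
theorem eq_zero_of_smul_pair_tensor_free {x y : R}
    (h : ∀ m : M, x • m = 0 → y • m = 0 → m = 0) (F : Type*) [AddCommGroup F]
    [Module R F] [Module.Free R F] (t : M ⊗[R] F) (hx : x • t = 0) (hy : y • t = 0) : t = 0 := by
  let e := TensorProduct.equivFinsuppOfBasisRight (M := M) (Module.Free.chooseBasis R F)
  refine e.injective (Finsupp.ext fun i ↦ ?_)
  rw [map_zero]
  refine h _ ?_ ?_
  · rw [← Finsupp.smul_apply, ← map_smul, hx]; simp
  · rw [← Finsupp.smul_apply, ← map_smul, hy]; simp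

end RegularPairs

/-! ### Grade of the cokernel of the dual presentation -/

section Annihilator

variable {R : Type u} [CommRing R] {F₁ F₀ M : Type*} [AddCommGroup F₁] [Module R F₁]
  [AddCommGroup F₀] [Module R F₀] [AddCommGroup M] [Module R M]
  [Module.Free R F₁] [Module.Finite R F₁]

/-- Each coordinate functional of F₁, multiplied by x, extends along A to F₀; these extensions are
the coordinates of B. -/
theorem exists_comp_eq_smul_id_of_mem_annihilator {A : F₁ →ₗ[R] F₀} {x : R}
    (hx : x ∈ Module.annihilator R (Module.Dual R F₁ ⧸ LinearMap.range A.dualMap)) :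
    ∃ B : F₀ →ₗ[R] F₁, B ∘ₗ A = x • LinearMap.id := by
  let b := Module.Free.chooseBasis R F₁
  have key (i) : ∃ ψ : Module.Dual R F₀, A.dualMap ψ = x • b.coord i := by
    have := Module.mem_annihilator.1 hx (Submodule.Quotient.mk (b.coord i))
    rwa [← Submodule.Quotient.mk_smul, Submodule.Quotient.mk_eq_zero] at this
  choose ψ hψ using key
  refine ⟨∑ i, LinearMap.toSpanSingleton R F₁ (b i) ∘ₗ ψ i, ?_⟩
  ext v
  have hψv (i) : ψ i (A v) = x * b.repr v i := by simpa using LinearMap.congr_fun (hψ i) v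
  simp only [LinearMap.comp_apply, LinearMap.sum_apply, LinearMap.toSpanSingleton_apply, hψv,
    mul_smul, ← Finset.smul_sum, LinearMap.smul_apply, LinearMap.id_apply, b.sum_repr]

/-- If a torsion-free module has a free resolution of length one, then the cokernel of the dual
presentation is annihilated by a regular sequence of length two. -/
theorem exists_isWeaklyRegularPair_comp_eq_smul_id [IsNoetherianRing R] [Module.Free R F₀]
    [Module.Finite R F₀] {A : F₁ →ₗ[R] F₀}
    {π : F₀ →ₗ[R] M} (hA : Function.Injective A) (hAπ : Function.Exact A π)
    [Module.IsTorsionFree R M] :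
    ∃ x y : R, IsWeaklyRegularPair R x y ∧ (∃ B : F₀ →ₗ[R] F₁, B ∘ₗ A = x • LinearMap.id) ∧
      ∃ B : F₀ →ₗ[R] F₁, B ∘ₗ A = y • LinearMap.id := by
  let E := Module.Dual R F₁ ⧸ LinearMap.range A.dualMap
  let b := Module.Free.chooseBasis R F₁
  let c := Module.Free.chooseBasis R F₀
  -- Dualizing identifies Hom(E, R) with ker A.
  have h0 : Subsingleton (E →ₗ[R] R) := by
    refine subsingleton_of_forall_eq 0 fun φ ↦ ?_
    let φ' := φ ∘ₗ Submodule.mkQ _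
    have hφ' (ψ) : φ' (A.dualMap ψ) = 0 := by
      rw [LinearMap.comp_apply, Submodule.mkQ_apply,
        (Submodule.Quotient.mk_eq_zero _).2 (LinearMap.mem_range_self _ ψ), map_zero]
    obtain ⟨v, hv⟩ := (Module.bijective_dual_eval R F₁).surjective φ'
    have hv' (ξ) : ξ v = φ' ξ := LinearMap.congr_fun hv ξ
    have hAv : A v = 0 := by
      refine (Module.bijective_dual_eval R F₀).injective (LinearMap.ext fun ψ ↦ ?_)
      have := hv' (A.dualMap ψ)
      simp only [LinearMap.dualMap_apply] at this
      rw [Module.Dual.eval_apply, this, hφ', map_zero, LinearMap.zero_apply]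
    have hv0 : v = 0 := hA (by rw [hAv, map_zero])
    refine Submodule.linearMap_qext _ (LinearMap.ext fun ξ ↦ ?_)
    change φ' ξ = 0
    rw [← hv', hv0, map_zero]
  obtain ⟨x, hxE, hx⟩ := IsSMulRegular.subsingleton_linearMap_iff.1 h0
  have hxM : IsSMulRegular M x :=
    Module.IsTorsionFree.isSMulRegular (isLeftRegular_iff_isRegular.1 hx)
  -- Hom(E, R/x) is the kernel of A mod x, namely Tor₁(M, R/x), which vanishes because x is regular
  -- on M.
  have h1 : Subsingleton (E →ₗ[R] QuotSMulTop x R) := by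
    refine subsingleton_of_forall_eq 0 fun φ ↦ ?_
    let φ' := φ ∘ₗ Submodule.mkQ _
    have hφ' (ψ) : φ' (A.dualMap ψ) = 0 := by
      rw [LinearMap.comp_apply, Submodule.mkQ_apply,
        (Submodule.Quotient.mk_eq_zero _).2 (LinearMap.mem_range_self _ ψ), map_zero]
    choose s hs using fun i ↦ Submodule.mkQ_surjective _ (φ' (b.coord i))
    let v := ∑ i, s i • b i
    have hv' (ξ : Module.Dual R F₁) : φ' ξ = Submodule.mkQ _ (ξ v) := by
      have : φ' = Submodule.mkQ _ ∘ₗ Module.Dual.eval R F₁ v := by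
        refine b.dualBasis.ext fun i ↦ ?_
        rw [Module.Basis.coe_dualBasis, ← hs, LinearMap.comp_apply]
        congr 1
        simp [v, Finsupp.single_apply]
      rw [this]; rfl
    have hAv : ∃ w, A v = x • w := by
      have key (i) : ∃ r, c.coord i (A v) = x • r := by
        have := hv' (A.dualMap (c.coord i))
        rw [hφ', eq_comm, Submodule.mkQ_apply,
          Submodule.Quotient.mk_eq_zero, Submodule.mem_smul_pointwise_iff_exists] at this
        obtain ⟨r, -, hr⟩ := this
        exact ⟨r, hr.symm⟩
      choose r hr using key
      refine ⟨∑ i, r i • c i, ?_⟩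
      rw [← c.sum_repr (A v), Finset.smul_sum]
      refine Finset.sum_congr rfl fun i _ ↦ ?_
      rw [← smul_assoc, ← hr]; rfl
    obtain ⟨w, hw⟩ := hAv
    obtain ⟨v', rfl⟩ := (hAπ w).1 (hxM.eq_zero_of_smul (by
      rw [← map_smul, ← hw]; exact hAπ.apply_apply_eq_zero v))
    have hv : v = x • v' := hA (by rw [hw, map_smul])
    refine Submodule.linearMap_qext _ (LinearMap.ext fun ξ ↦ ?_)
    change φ' ξ = 0
    rw [hv', hv, map_smul, Submodule.mkQ_apply, Submodule.Quotient.mk_eq_zero]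
    exact Submodule.smul_mem_pointwise_smul _ _ _ trivial
  obtain ⟨y, hyE, hy⟩ := IsSMulRegular.subsingleton_linearMap_iff.1 h1
  exact ⟨x, y, ⟨hx, isSMulRegular_quotSMulTop_iff.1 hy⟩,
    exists_comp_eq_smul_id_of_mem_annihilator hxE, exists_comp_eq_smul_id_of_mem_annihilator hyE⟩

end Annihilator

/-! ### Kernels and torsion after tensoring the resolution -/

section TensorInjective

variable {R : Type u} [CommRing R] {F₁ F₀ M : Type*} [AddCommGroup F₁] [Module R F₁]
  [AddCommGroup F₀] [Module R F₀] [AddCommGroup M] [Module R M]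

theorem smul_eq_zero_of_lTensor_eq_zero {A : F₁ →ₗ[R] F₀} {B : F₀ →ₗ[R] F₁} {x : R}
    (h : B ∘ₗ A = x • LinearMap.id) {N : Type*} [AddCommGroup N] [Module R N] {t : N ⊗[R] F₁}
    (ht : A.lTensor N t = 0) : x • t = 0 := by
  have : (B ∘ₗ A).lTensor N t = 0 := by
    rw [LinearMap.lTensor_comp, LinearMap.comp_apply, ht, map_zero]
  simpa [h, LinearMap.lTensor_smul] using this

/-- If `0 → F₁ → F₀ → M` stays exact after tensoring with `N` and `x, y` is weakly regular on `N`,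
then no nonzero element of `N ⊗ M` is killed by `x` and `y`. -/
theorem eq_zero_of_smul_pair_tensor [Module.Free R F₁] [Module.Free R F₀] {A : F₁ →ₗ[R] F₀}
    {π : F₀ →ₗ[R] M} (hAπ : Function.Exact A π) (hπ : Function.Surjective π)
    {N : Type*} [AddCommGroup N] [Module R N] (hA : Function.Injective (A.lTensor N)) {x y : R}
    (h : IsWeaklyRegularPair N x y) (u : N ⊗[R] M) (hx : x • u = 0) (hy : y • u = 0) : u = 0 := by
  have hex := lTensor_exact N hAπ hπ
  obtain ⟨v, rfl⟩ := LinearMap.lTensor_surjective N hπ u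
  obtain ⟨w₁, hw₁⟩ := (hex (x • v)).1 (by rw [map_smul, hx])
  obtain ⟨w₂, hw₂⟩ := (hex (y • v)).1 (by rw [map_smul, hy])
  -- Both y • w₁ and x • w₂ map to xy • v, so they agree, and regularity of the pair divides w₁ by
  -- x.
  obtain ⟨w, rfl⟩ := (h.tensor_free F₁).right w₁ w₂ (hA (by
    rw [map_smul, map_smul, hw₁, hw₂, smul_comm]))
  have : v = A.lTensor N w := (h.left.tensor_free F₀) (by
    change x • v = x • _
    rw [← hw₁, map_smul])
  rw [this]
  exact hex.apply_apply_eq_zero w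

end TensorInjective

/-! ### Depth through Ext from the residue field -/

section LocalRingExt

open CategoryTheory Abelian IsLocalRing RingTheory.Sequence

section Depth

variable {R : Type u} [CommRing R] [IsLocalRing R]

theorem exists_isRegular_length_eq_of_localRingDepth {n : ℕ} (h : localRingDepth R = n)
    (hn : n ≠ 0) :
    ∃ rs : List R, IsRegular R rs ∧ (∀ r ∈ rs, r ∈ maximalIdeal R) ∧ rs.length = n := by
  by_contra! hlt
  -- If no sequence attains n, all have length at most n - 1; `hn` keeps the truncated subtraction
  -- honest.
  have : localRingDepth R ≤ (n - 1 : ℕ) := by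
    refine iSup₂_le fun rs hrs ↦ ?_
    have h1 : (rs.length : ℕ∞) ≤ n := h ▸ le_iSup₂_of_le rs hrs le_rfl
    have h2 := hlt rs hrs.1 hrs.2
    norm_cast at h1 ⊢
    omega
  rw [h] at this
  norm_cast at this
  omega

theorem length_le_of_localRingDepth {n : ℕ} (h : localRingDepth R = n) {rs : List R}
    (hrs : IsRegular R rs) (hmem : ∀ r ∈ rs, r ∈ maximalIdeal R) : rs.length ≤ n := by
  have h1 : (rs.length : ℕ∞) ≤ n := h ▸ le_iSup₂_of_le rs ⟨hrs, hmem⟩ le_rfl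
  exact_mod_cast h1

end Depth

theorem maximalIdeal_smul_top_lt_top {R N : Type*} [CommRing R] [IsLocalRing R] [AddCommGroup N]
    [Module R N] [Module.Finite R N] [Nontrivial N] :
    maximalIdeal R • (⊤ : Submodule R N) < ⊤ :=
  (Submodule.top_ne_ideal_smul_of_le_jacobson_annihilator
    (IsLocalRing.maximalIdeal_le_jacobson _)).symm.lt_top

theorem RingTheory.Sequence.IsWeaklyRegular.of_free {R : Type*} [CommRing R] {rs : List R}
    (hrs : IsWeaklyRegular R rs) (F : Type*) [AddCommGroup F] [Module R F] [Module.Free R F] :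
    IsWeaklyRegular F rs :=
  ((TensorProduct.rid R F).isWeaklyRegular_congr rs).1 hrs.isWeaklyRegular_lTensor

section ModuleCatShortExact

variable {R : Type u} [CommRing R] {X₁ X₂ X₃ : Type v}
  [AddCommGroup X₁] [Module R X₁] [AddCommGroup X₂] [Module R X₂]
  [AddCommGroup X₃] [Module R X₃] {f : X₁ →ₗ[R] X₂} {g : X₂ →ₗ[R] X₃}

theorem ModuleCat.shortExact_of_exact (hf : Function.Injective f) (hfg : Function.Exact f g)
    (hg : Function.Surjective g) :
    (ShortComplex.mk (ModuleCat.ofHom f) (ModuleCat.ofHom g)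
      (by ext x; exact hfg.apply_apply_eq_zero x)).ShortExact where
  exact := (ShortComplex.ShortExact.moduleCat_exact_iff_function_exact _).2 hfg
  mono_f := (ModuleCat.mono_iff_injective _).2 hf
  epi_g := (ModuleCat.epi_iff_surjective _).2 hg

end ModuleCatShortExact

section ResidueExt

variable (R : Type u) [CommRing R] [IsLocalRing R] [Small.{v} R]

/-- The residue field of a local ring, as a module in a universe where the ring is small. -/
noncomputable abbrev residueModule : ModuleCat.{v} R :=
  ModuleCat.of R (Shrink.{v} (R ⧸ maximalIdeal R))

/-- `Extⁱ(k, N) = 0` for the residue field `k`. -/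
abbrev ResidueExtVanishes (N : Type v) [AddCommGroup N] [Module R N] (i : ℕ) : Prop :=
  Subsingleton (Ext.{v} (residueModule.{u, v} R) (ModuleCat.of R N) i)

variable {R}
variable {N N' : Type v} [AddCommGroup N] [Module R N] [AddCommGroup N'] [Module R N']

theorem residueModule_annihilator :
    Module.annihilator R (residueModule.{u, v} R) = maximalIdeal R := by
  rw [(Shrink.linearEquiv R (R ⧸ maximalIdeal R)).annihilator_eq, Ideal.annihilator_quotient]

theorem smul_ext_residueModule_eq_zero {r : R} (hr : r ∈ maximalIdeal R) {X : ModuleCat.{v} R}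
    {i : ℕ} (e : Ext.{v} (residueModule.{u, v} R) X i) : r • e = 0 := by
  rw [← residueModule_annihilator (R := R)] at hr
  have h : r • 𝟙 (residueModule.{u, v} R) = 0 := by
    refine ModuleCat.hom_ext (LinearMap.ext fun x ↦ ?_)
    exact Module.mem_annihilator.1 hr x
  rw [← Ext.mk₀_id_comp e, ← Ext.smul_comp, ← Ext.mk₀_smul, h, Ext.mk₀_zero, Ext.zero_comp]

/-- The maximal ideal kills k, hence Ext(k, -), and composition is linear in the map. -/
theorem ext_comp_mk₀_eq_zero {f : N →ₗ[R] N'}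
    (hf : f ∈ maximalIdeal R • (⊤ : Submodule R (N →ₗ[R] N'))) {i : ℕ}
    (e : Ext.{v} (residueModule.{u, v} R) (ModuleCat.of R N) i) :
    e.comp (Ext.mk₀ (ModuleCat.ofHom f)) (add_zero i) = 0 := by
  refine Submodule.smul_induction_on (p := fun g ↦
    e.comp (Ext.mk₀ (ModuleCat.ofHom g)) (add_zero i) = 0) hf (fun r hr g _ ↦ ?_) fun g g' h h' ↦ ?_
  · rw [show ModuleCat.ofHom (r • g) = r • ModuleCat.ofHom g from rfl, Ext.mk₀_smul, Ext.comp_smul,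
      smul_ext_residueModule_eq_zero hr]
  · rw [show ModuleCat.ofHom (g + g') = ModuleCat.ofHom g + ModuleCat.ofHom g' from rfl,
      Ext.mk₀_add, Ext.comp_add, h, h', add_zero]

theorem ResidueExtVanishes.of_retract {s : N →ₗ[R] N'} {r : N' →ₗ[R] N}
    (hrs : r ∘ₗ s = LinearMap.id) {i : ℕ} (h : ResidueExtVanishes R N' i) :
    ResidueExtVanishes R N i := by
  refine subsingleton_of_forall_eq 0 fun e ↦ ?_
  have : e.comp (Ext.mk₀ (ModuleCat.ofHom s)) (add_zero i) = 0 := Subsingleton.elim _ _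
  have h2 : ModuleCat.ofHom s ≫ ModuleCat.ofHom r = 𝟙 (ModuleCat.of R N) := by
    rw [← ModuleCat.ofHom_comp, hrs]; rfl
  rw [← Ext.comp_mk₀_id e, ← h2, ← Ext.mk₀_comp_mk₀,
    ← Ext.comp_assoc_of_second_deg_zero, this, Ext.zero_comp]

theorem ResidueExtVanishes.of_tensor_free (F : Type v) [AddCommGroup F] [Module R F]
    [Module.Free R F] [Nontrivial F] {i : ℕ} (h : ResidueExtVanishes R (N ⊗[R] F) i) :
    ResidueExtVanishes R N i := by
  let b := Module.Free.chooseBasis R F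
  obtain ⟨j⟩ := b.index_nonempty
  refine h.of_retract (s := (TensorProduct.mk R N F).flip (b j))
    (r := (TensorProduct.rid R N).toLinearMap ∘ₗ (b.coord j).lTensor N) ?_
  ext x
  simp

theorem ResidueExtVanishes.zero_of_isSMulRegular {x : R} (hx : x ∈ maximalIdeal R)
    (h : IsSMulRegular N x) : ResidueExtVanishes R N 0 := by
  rw [← residueModule_annihilator.{u, v} (R := R)] at hx
  have := h.linearMap_subsingleton_of_mem_annihilator hx
  exact (Ext.addEquiv₀.trans ModuleCat.homAddEquiv).subsingleton

section ShortExact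

variable {X₁ X₂ X₃ : Type v} [AddCommGroup X₁] [Module R X₁] [AddCommGroup X₂] [Module R X₂]
  [AddCommGroup X₃] [Module R X₃] {f : X₁ →ₗ[R] X₂} {g : X₂ →ₗ[R] X₃}

/-- If `0 → X₁ → X₂ → X₃ → 0` is exact and the first map has coefficients in the maximal ideal,
then vanishing of `Extⁱ(k, X₃)` forces vanishing of `Extⁱ⁺¹(k, X₁)`. -/
theorem ResidueExtVanishes.succ_of_minimal (hf : Function.Injective f) (hfg : Function.Exact f g)
    (hg : Function.Surjective g)
    (hm : f ∈ maximalIdeal R • (⊤ : Submodule R (X₁ →ₗ[R] X₂))) {i : ℕ}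
    (h : ResidueExtVanishes R X₃ i) : ResidueExtVanishes R X₁ (i + 1) := by
  refine subsingleton_of_forall_eq 0 fun e ↦ ?_
  obtain ⟨e', rfl⟩ := Ext.covariant_sequence_exact₁ _ (ModuleCat.shortExact_of_exact hf hfg hg) e
    (ext_comp_mk₀_eq_zero hm e) rfl
  have : e' = 0 := h.elim _ _
  rw [this, Ext.zero_comp]

theorem ResidueExtVanishes.succ_of_middle (hf : Function.Injective f) (hfg : Function.Exact f g)
    (hg : Function.Surjective g) {i : ℕ} (h₂ : ResidueExtVanishes R X₂ (i + 1))
    (h : ResidueExtVanishes R X₃ i) : ResidueExtVanishes R X₁ (i + 1) := by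
  refine subsingleton_of_forall_eq 0 fun e ↦ ?_
  obtain ⟨e', rfl⟩ := Ext.covariant_sequence_exact₁ _ (ModuleCat.shortExact_of_exact hf hfg hg) e
    (h₂.elim _ _) rfl
  have : e' = 0 := h.elim _ _
  rw [this, Ext.zero_comp]

theorem ResidueExtVanishes.zero_of_injective (hf : Function.Injective f)
    (h₂ : ResidueExtVanishes R X₂ 0) : ResidueExtVanishes R X₁ 0 := by
  have : Mono (ModuleCat.ofHom f) := (ModuleCat.mono_iff_injective _).2 hf
  exact (Ext.postcomp_mk₀_injective_of_mono _ (ModuleCat.ofHom f)).subsingleton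

theorem ResidueExtVanishes.zero_of_minimal (hf : Function.Injective f)
    (hm : f ∈ maximalIdeal R • (⊤ : Submodule R (X₁ →ₗ[R] X₂))) : ResidueExtVanishes R X₁ 0 := by
  have : Mono (ModuleCat.ofHom f) := (ModuleCat.mono_iff_injective _).2 hf
  refine subsingleton_of_forall_eq 0 fun e ↦ ?_
  refine Ext.postcomp_mk₀_injective_of_mono _ (ModuleCat.ofHom f) ?_
  rw [map_zero]
  exact ext_comp_mk₀_eq_zero hm e

end ShortExact

theorem residueModule_support :
    Module.support R (residueModule.{u, v} R) = PrimeSpectrum.zeroLocus (maximalIdeal R) := by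
  rw [(Shrink.linearEquiv R _).support_eq, Module.support_eq_zeroLocus,
    Ideal.annihilator_quotient]

section Noetherian

variable [IsNoetherianRing R]

instance : Module.Finite R (residueModule.{u, v} R) :=
  Module.Finite.equiv (Shrink.linearEquiv R (R ⧸ maximalIdeal R)).symm

theorem ResidueExtVanishes.of_isWeaklyRegular [Module.Finite R N] {rs : List R}
    (hrs : IsWeaklyRegular N rs) (hmem : ∀ r ∈ rs, r ∈ maximalIdeal R) {i : ℕ}
    (hi : i < rs.length) : ResidueExtVanishes R N i := by
  cases subsingleton_or_nontrivial N
  · refine subsingleton_of_forall_eq 0 fun e ↦ ?_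
    have : 𝟙 (ModuleCat.of R N) = 0 := by ext x; exact Subsingleton.elim _ _
    rw [← Ext.comp_mk₀_id e, this, Ext.mk₀_zero, Ext.comp_zero]
  · exact ModuleCat.subsingleton_ext_of_exists_isRegular (maximalIdeal R) _
      residueModule_support.subset (ModuleCat.of R N) maximalIdeal_smul_top_lt_top rs hmem
      ((IsLocalRing.isRegular_iff_isWeaklyRegular_of_subset_maximalIdeal hmem).2 hrs) i hi

/-- Over a local ring of depth `n`, a finite free module `F` with `Extⁱ(k, F) = 0` for all `i ≤ n`
is zero. -/
theorem subsingleton_of_residueExtVanishes_of_free {n : ℕ} (hR : localRingDepth R = n)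
    (F : Type v) [AddCommGroup F] [Module R F] [Module.Free R F]
    (h : ∀ i ≤ n, ResidueExtVanishes R F i) : Subsingleton F := by
  by_contra hF
  rw [not_subsingleton_iff_nontrivial] at hF
  let b := Module.Free.chooseBasis R F
  obtain ⟨j⟩ := b.index_nonempty
  let e := Shrink.linearEquiv.{v} R R
  have : Module.Finite R (Shrink.{v} R) := Module.Finite.equiv e.symm
  -- R is a retract of F; n + 1 vanishing Ext groups would yield a regular sequence longer than the
  -- depth.
  have hS (i) (hi : i < n + 1) : ResidueExtVanishes R (Shrink.{v} R) i := by
    refine (h i (by omega)).of_retract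
      (s := LinearMap.toSpanSingleton R F (b j) ∘ₗ e.toLinearMap)
      (r := e.symm.toLinearMap ∘ₗ b.coord j) ?_
    ext x
    simp
  obtain ⟨rs, hlen, hmem, hrs⟩ := ModuleCat.exists_isRegular_of_exists_subsingleton_ext
    (maximalIdeal R) (n + 1) (ModuleCat.of R (Shrink.{v} R)) maximalIdeal_smul_top_lt_top
    (residueModule.{u, v} R) residueModule_support hS
  have := length_le_of_localRingDepth hR ((e.isRegular_congr rs).1 hrs) hmem
  omega

/-- A finitely generated module of finite projective dimension whose depth is at least that of the
ring is free. -/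
theorem free_of_residueExtVanishes {n : ℕ} (hR : localRingDepth R = n) {d : ℕ}
    {K : Type v} [AddCommGroup K] [Module R K] [Module.Finite R K]
    (hd : HasProjectiveDimensionLT (ModuleCat.of R K) d)
    (hK : ∀ i < n, ResidueExtVanishes R K i) : Module.Free R K := by
  induction d generalizing K with
  | zero =>
    have := ModuleCat.subsingleton_of_isZero
      (isZero_of_hasProjectiveDimensionLT_zero (ModuleCat.of R K))
    exact Module.Free.of_subsingleton R K
  | succ d ih =>
    cases d with
    | zero =>
      have : Module.Projective R K := (IsProjective.iff_projective _).2
        (projective_iff_hasProjectiveDimensionLT_one.2 hd)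
      exact Module.free_of_flat_of_isLocalRing
    | succ d =>
      obtain ⟨F, _, _, _, _, π, hπ, hker⟩ := exists_minimal_free_cover.{u, v} (R := R) K
      let A := (LinearMap.ker π).subtype
      have hA : Function.Injective A := Subtype.val_injective
      have hAπ : Function.Exact A π := LinearMap.exact_subtype_ker_map π
      have hse := ModuleCat.shortExact_of_exact hA hAπ hπ
      have hpF : Projective (ModuleCat.of R F) := (IsProjective.iff_projective _).1 inferInstance
      have hd' : HasProjectiveDimensionLT (ModuleCat.of R (LinearMap.ker π)) (d + 1) :=
        (hse.hasProjectiveDimensionLT_X₃_iff d hpF).1 hd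
      have hF (i) (hi : i < n) : ResidueExtVanishes R F i := by
        obtain ⟨rs, hrs, hmem, rfl⟩ := exists_isRegular_length_eq_of_localRingDepth hR (by omega)
        exact .of_isWeaklyRegular (hrs.toIsWeaklyRegular.of_free F) hmem hi
      have hk (i) (hi : i < n) : ResidueExtVanishes R (LinearMap.ker π) i := by
        cases i with
        | zero => exact (hF 0 hi).zero_of_injective hA
        | succ i => exact .succ_of_middle hA hAπ hπ (hF _ hi) (hK i (by omega))
      have hfree := ih hd' hk
      have hm : A ∈ maximalIdeal R • (⊤ : Submodule R (LinearMap.ker π →ₗ[R] F)) :=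
        LinearMap.mem_ideal_smul_top_of_range_le (by rwa [Submodule.range_subtype])
      -- The syzygy is now known to be free. Minimality gives its vanishing one degree above that of
      -- K, hence up to degree n, which forces it to be zero.
      have hsub : Subsingleton (LinearMap.ker π) := by
        refine subsingleton_of_residueExtVanishes_of_free hR _ fun i hi ↦ ?_
        cases i with
        | zero => exact .zero_of_minimal hA hm
        | succ i => exact (hK i (by omega)).succ_of_minimal hA hAπ hπ hm
      have hinj : Function.Injective π :=
        LinearMap.ker_eq_bot.1 ((Submodule.subsingleton_iff_eq_bot).1 hsub)
      exact Module.Free.of_equiv (LinearEquiv.ofBijective π ⟨hinj, hπ⟩)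

end Noetherian

end ResidueExt

end LocalRingExt

/-! ### The depth three argument -/

section DepthThree

open CategoryTheory Abelian IsLocalRing RingTheory.Sequence

/-- Over a local ring of depth three, if a reflexive module has a minimal free resolution of length
at most one and its third tensor power is torsion-free, then the resolution has length zero. -/
theorem subsingleton_of_tensorPower_isTorsionFree {R : Type u} [CommRing R] [IsLocalRing R]
    [IsNoetherianRing R] [Small.{v} R] (hR : localRingDepth R = 3)
    {F₁ F₀ M : Type v} [AddCommGroup F₁] [Module R F₁] [Module.Free R F₁] [Module.Finite R F₁]
    [AddCommGroup F₀] [Module R F₀] [Module.Free R F₀] [Module.Finite R F₀]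
    [AddCommGroup M] [Module R M] [Module.IsReflexive R M]
    {A : F₁ →ₗ[R] F₀} {π : F₀ →ₗ[R] M} (hA : Function.Injective A) (hAπ : Function.Exact A π)
    (hπ : Function.Surjective π) (hm : A ∈ maximalIdeal R • (⊤ : Submodule R (F₁ →ₗ[R] F₀)))
    (htf : Module.IsTorsionFree R ((M ⊗[R] M) ⊗[R] M)) : Subsingleton F₁ := by
  by_contra hF₁
  rw [not_subsingleton_iff_nontrivial] at hF₁
  have hMtf : Module.IsTorsionFree R M := Module.IsReflexive.isTorsionFree
  obtain ⟨x, y, hxy, ⟨B, hB⟩, ⟨C, hC⟩⟩ := exists_isWeaklyRegularPair_comp_eq_smul_id hA hAπ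
  have hxyM : IsWeaklyRegularPair M x y := .of_isReflexive hxy
  have hA₂ : Function.Injective (A.lTensor M) := by
    rw [injective_iff_map_eq_zero]
    exact fun t ht ↦ (hxyM.left.tensor_free F₁).eq_zero_of_smul
      (smul_eq_zero_of_lTensor_eq_zero hB ht)
  -- Here x alone need not be regular on M ⊗ M, so both x and y are needed.
  have hA₃ : Function.Injective (A.lTensor (M ⊗[R] M)) := by
    rw [injective_iff_map_eq_zero]
    exact fun t ht ↦ eq_zero_of_smul_pair_tensor_free
      (eq_zero_of_smul_pair_tensor hAπ hπ hA₂ hxyM) F₁ t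
      (smul_eq_zero_of_lTensor_eq_zero hB ht) (smul_eq_zero_of_lTensor_eq_zero hC ht)
  obtain ⟨rs, hrs, hmem, hlen⟩ :=
    exists_isRegular_length_eq_of_localRingDepth (n := 3) hR (by omega)
  obtain ⟨z, rs, rfl⟩ := List.exists_cons_of_length_pos (l := rs) (by omega)
  have hz : IsRegular z := isLeftRegular_iff_isRegular.1 ((isRegular_cons_iff R z rs).1 hrs).1
  have h₀ : ResidueExtVanishes R ((M ⊗[R] M) ⊗[R] M) 0 :=
    .zero_of_isSMulRegular (hmem z (by simp)) hz.isSMulRegular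
  have h₁ : ResidueExtVanishes R (M ⊗[R] M) 1 :=
    (h₀.succ_of_minimal hA₃ (lTensor_exact _ hAπ hπ) (LinearMap.lTensor_surjective _ hπ)
      (LinearMap.lTensor_mem_ideal_smul_top hm _)).of_tensor_free F₁
  have h₂ : ResidueExtVanishes R M 2 :=
    (h₁.succ_of_minimal hA₂ (lTensor_exact _ hAπ hπ) (LinearMap.lTensor_surjective _ hπ)
      (LinearMap.lTensor_mem_ideal_smul_top hm _)).of_tensor_free F₁
  have h₃ : ResidueExtVanishes R F₁ 3 := h₂.succ_of_minimal hA hAπ hπ hm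
  refine not_subsingleton F₁ (subsingleton_of_residueExtVanishes_of_free (n := 3) hR F₁ fun i hi ↦ ?_)
  rcases hi.lt_or_eq with hi | rfl
  · exact .of_isWeaklyRegular (hrs.toIsWeaklyRegular.of_free F₁) hmem (hlen ▸ hi)
  · exact h₃

/-- Over a local ring of depth three, a finite reflexive module of finite projective dimension is
the cokernel of a minimal injective map between finite free modules. -/
theorem exists_minimal_resolution_of_isReflexive {R : Type u} [CommRing R] [IsLocalRing R]
    [IsNoetherianRing R] [Small.{v} R] (hR : localRingDepth R = 3) (M : Type v) [AddCommGroup M]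
    [Module R M] [Module.Finite R M] [Module.IsReflexive R M]
    (hpd : projectiveDimension (ModuleCat.of R M) < ⊤) :
    ∃ (F : Type v) (_ : AddCommGroup F) (_ : Module R F) (_ : Module.Free R F)
      (_ : Module.Finite R F) (π : F →ₗ[R] M), Function.Surjective π ∧
        LinearMap.ker π ≤ maximalIdeal R • (⊤ : Submodule R F) ∧
        Module.Free R (LinearMap.ker π) := by
  obtain ⟨F, _, _, _, _, π, hπ, hker⟩ := exists_minimal_free_cover.{u, v} (R := R) M
  refine ⟨F, _, _, ‹_›, ‹_›, π, hπ, hker, ?_⟩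
  let A := (LinearMap.ker π).subtype
  have hA : Function.Injective A := Subtype.val_injective
  have hAπ : Function.Exact A π := LinearMap.exact_subtype_ker_map π
  obtain ⟨d, hd⟩ := (projectiveDimension_ne_top_iff _).1 hpd.ne
  have hpF : Projective (ModuleCat.of R F) := (IsProjective.iff_projective _).1 inferInstance
  have hd' : HasProjectiveDimensionLT (ModuleCat.of R (LinearMap.ker π)) (d + 1) :=
    ((ModuleCat.shortExact_of_exact hA hAπ hπ).hasProjectiveDimensionLT_X₃_iff d hpF).1
      (hasProjectiveDimensionLT_of_ge _ (d + 1) _ (by omega))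
  obtain ⟨rs, hrs, hmem, hlen⟩ :=
    exists_isRegular_length_eq_of_localRingDepth (n := 3) hR (by omega)
  have hF (i) (hi : i < 3) : ResidueExtVanishes R F i :=
    .of_isWeaklyRegular (hrs.toIsWeaklyRegular.of_free F) hmem (hlen ▸ hi)
  obtain ⟨x, y, z, rfl⟩ := List.length_eq_three.1 hlen
  have hxy : IsWeaklyRegularPair R x y :=
    isWeaklyRegularPair_iff.2 ((isWeaklyRegular_append_iff R [x, y] [z]).1 hrs.toIsWeaklyRegular).1
  -- Reflexivity transfers only the first two members of the regular sequence to M; the syzygy gains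
  -- the third degree.
  have hM (i) (hi : i < 2) : ResidueExtVanishes R M i :=
    .of_isWeaklyRegular (isWeaklyRegularPair_iff.1 (.of_isReflexive hxy))
      (fun r hr ↦ hmem r (by simp at hr ⊢; tauto)) hi
  refine free_of_residueExtVanishes (n := 3) hR hd' fun i hi ↦ ?_
  cases i with
  | zero => exact (hF 0 hi).zero_of_injective hA
  | succ i => exact .succ_of_middle hA hAπ hπ (hF _ hi) (hM i (by omega))

end DepthThree

theorem mainTheorem6 (R : Type u) [CommRing R] [IsCohenMacaulayLocalRing R]
    (hdim : ringKrullDim R = 3)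
    (M : Type v) [AddCommGroup M] [Module R M] [Small.{v} R] [Module.Finite R M]
    (hrefl : Module.IsReflexive R M)
    (hpd : CategoryTheory.projectiveDimension (ModuleCat.of R M) < ⊤)
    (htf : Module.IsTorsionFree R ((M ⊗[R] M) ⊗[R] M)) :
    Module.Free R M := by
  have hR : localRingDepth R = 3 := by
    have h := (IsCohenMacaulayLocalRing.depth_eq_dim (R := R)).trans hdim
    exact WithBot.coe_injective h
  obtain ⟨F, _, _, _, _, π, hπ, hker, _⟩ := exists_minimal_resolution_of_isReflexive hR M hpd
  have hm : (LinearMap.ker π).subtype ∈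
      IsLocalRing.maximalIdeal R • (⊤ : Submodule R (LinearMap.ker π →ₗ[R] F)) :=
    LinearMap.mem_ideal_smul_top_of_range_le (by rwa [Submodule.range_subtype])
  have hsub : Subsingleton (LinearMap.ker π) :=
    subsingleton_of_tensorPower_isTorsionFree hR Subtype.val_injective
      (LinearMap.exact_subtype_ker_map π) hπ hm htf
  have hinj : Function.Injective π :=
    LinearMap.ker_eq_bot.1 (Submodule.subsingleton_iff_eq_bot.1 hsub)
  exact Module.Free.of_equiv (LinearEquiv.ofBijective π ⟨hinj, hπ⟩)
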